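/- Let $\mathfrak L$ be the BMS-Kac-Moody algebra: the complex Lie algebra with basis $\{L_m, M_m, S_m, I_m \mid m\in\mathbb Z\}$ and nontrivial brackets $$[L_m,L_n]=(n-m)L_{m+n},\quad [L_m,M_n]=(n-m)M_{m+n},\quad [L_m,S_n]=nS_{m+n},\quad [L_m,I_n]=nI_{m+n},\quad [M_m,I_n]=-nS_{m+n}\qquad(m,n\in\mathbb Z).$$ For $\lambda\in\mathbb C^*$, $\alpha,\beta,\gamma\in\mathbb C$ and $h(t)\in\mathbb C[t]$ put $h_m(t)=m\,h(t)-m(m-1)\alpha\frac{h(t)-h(\alpha)}{t-\alpha}$ for $m\in\mathbb Z$, and let $\Phi(\lambda,\alpha,\beta,\gamma,h(t))$ be the $\mathfrak L$-module with underlying space $\mathbb C[s,t]$ and action $$\begin{aligned} L_m\cdot f(s,t)&=\lambda^m\big(s+h_m(t)\big)f(s-m,t)-m\lambda^m(t-m\alpha)\tfrac{\partial}{\partial t}\big(f(s-m,t)\big),\\ M_m\cdot f(s,t)&=\lambda^m(t-m\alpha)f(s-m,t),\\ S_m\cdot f(s,t)&=\lambda^m\beta f(s-m,t),\\ I_m\cdot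 f(s,t)&=\lambda^m\Big(\gamma-m\beta\tfrac{h(t)-h(\alpha)}{t-\alpha}\Big)f(s-m,t)+m\lambda^m\beta\tfrac{\partial}{\partial t}\big(f(s-m,t)\big). \end{aligned}$$ Theorem. Let $V$ be an $\mathfrak L$-module whose restriction to the universal enveloping algebra $U(\mathbb CL_0\oplus\mathbb CM_0)$ is free of rank one. Then $V\cong\Phi(\lambda,\alpha,\beta,\gamma,h(t))$ as $\mathfrak L$-modules for some $\lambda\in\mathbb C^*$, $\alpha,\beta,\gamma\in\mathbb C$ and $h(t)\in\mathbb C[t]$. This is the complete classification of such modules: conversely, the restriction of every $\Phi(\lambda,\alpha,\beta,\gamma,h(t))$ to $U(\mathbb CL_0\oplus\mathbb CM_0)$ is free of rank one, and if $\Phi(\lambda,\alpha,\beta,\gamma,h(t))\cong\Phi(\lambda',\alpha',\beta',\gamma',q(t))$, then $(\lambda,\alpha,\beta,\gamma,h(t))=(\lambda',\alpha',\beta',\gamma',q(t))$. -/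

import Mathlib

/-- The four families of basis vectors of the BMS-Kac-Moody algebra. -/
inductive BMSGen : Type
  | L | M | S | I

/-- The underlying space of the BMS-Kac-Moody algebra: the complex vector space with basis
`L m, M m, S m, I m` for `m : ℤ`. -/
def BMSKacMoody : Type := (BMSGen × ℤ) →₀ ℂ

namespace BMSKacMoody

noncomputable instance : AddCommGroup BMSKacMoody :=
  inferInstanceAs (AddCommGroup ((BMSGen × ℤ) →₀ ℂ))

noncomputable instance : Module ℂ BMSKacMoody :=
  inferInstanceAs (Module ℂ ((BMSGen × ℤ) →₀ ℂ))

/-- The basis of the BMS-Kac-Moody algebra. -/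
noncomputable def basis : Module.Basis (BMSGen × ℤ) ℂ BMSKacMoody :=
  Module.Basis.ofRepr (LinearEquiv.refl ℂ ((BMSGen × ℤ) →₀ ℂ))

noncomputable def L (m : ℤ) : BMSKacMoody := basis (BMSGen.L, m)
noncomputable def M (m : ℤ) : BMSKacMoody := basis (BMSGen.M, m)
noncomputable def S (m : ℤ) : BMSKacMoody := basis (BMSGen.S, m)
noncomputable def I (m : ℤ) : BMSKacMoody := basis (BMSGen.I, m)

theorem induction_basis {p : BMSKacMoody → Prop} (hb : ∀ i, p (basis i)) (h0 : p 0)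
    (ha : ∀ x y, p x → p y → p (x + y)) (hs : ∀ (c : ℂ) x, p x → p (c • x))
    (x : BMSKacMoody) : p x := by
  have hx : x ∈ Submodule.span ℂ (Set.range basis) := by
    rw [basis.span_eq]; exact Submodule.mem_top
  induction hx using Submodule.span_induction with
  | mem x h => obtain ⟨i, rfl⟩ := h; exact hb i
  | zero => exact h0
  | add x y _ _ hx hy => exact ha x y hx hy
  | smul c x _ hx => exact hs c x hx

/-- The bracket on basis vectors:
`[L m, L n] = (n - m) L (m + n)`, `[L m, M n] = (n - m) M (m + n)`, `[L m, S n] = n S (m + n)`,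
`[L m, I n] = n I (m + n)`, `[M m, I n] = - n S (m + n)`, those that follow by antisymmetry,
and zero otherwise. -/
noncomputable def bracketGen : BMSGen × ℤ → BMSGen × ℤ → BMSKacMoody
  | (.L, m), (.L, n) => ((n : ℂ) - m) • L (m + n)
  | (.L, m), (.M, n) => ((n : ℂ) - m) • M (m + n)
  | (.M, m), (.L, n) => ((n : ℂ) - m) • M (m + n)
  | (.L, m), (.S, n) => (n : ℂ) • S (m + n)
  | (.S, m), (.L, n) => (-(m : ℂ)) • S (m + n)
  | (.L, m), (.I, n) => (n : ℂ) • I (m + n)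
  | (.I, m), (.L, n) => (-(m : ℂ)) • I (m + n)
  | (.M, m), (.I, n) => (-(n : ℂ)) • S (m + n)
  | (.I, m), (.M, n) => (m : ℂ) • S (m + n)
  | (.M, _), (.M, _) => 0
  | (.M, _), (.S, _) => 0
  | (.S, _), (.M, _) => 0
  | (.S, _), (.S, _) => 0
  | (.S, _), (.I, _) => 0
  | (.I, _), (.S, _) => 0
  | (.I, _), (.I, _) => 0

/-- The bilinear extension of the bracket. -/
noncomputable def bracketBilin : BMSKacMoody →ₗ[ℂ] BMSKacMoody →ₗ[ℂ] BMSKacMoody :=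
  basis.constr ℂ fun x => basis.constr ℂ fun y => bracketGen x y

theorem bracketBilin_basis (x y : BMSGen × ℤ) :
    bracketBilin (basis x) (basis y) = bracketGen x y := by
  simp [bracketBilin]

theorem bracketBilin_antisymm (x y : BMSKacMoody) :
    bracketBilin x y = -bracketBilin y x := by
  have h : bracketBilin = -bracketBilin.flip := by
    refine basis.ext fun a => basis.ext fun b => ?_
    simp only [LinearMap.neg_apply, LinearMap.flip_apply, bracketBilin_basis]
    obtain ⟨a, m⟩ := a
    obtain ⟨b, n⟩ := b
    cases a <;> cases b <;>
      simp only [bracketGen, ← neg_smul, add_comm n m, neg_zero, neg_sub, neg_neg]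
  simpa using congrArg (fun f => f x y) h

theorem bracketBilin_leibniz (x y z : BMSKacMoody) :
    bracketBilin x (bracketBilin y z) =
      bracketBilin (bracketBilin x y) z + bracketBilin y (bracketBilin x z) := by
  induction x using induction_basis with
  | h0 => simp
  | ha u v hu hv => simp only [map_add, LinearMap.add_apply, hu, hv]; abel
  | hs c u hu => simp only [map_smul, LinearMap.smul_apply, hu, smul_add]
  | hb a =>
  induction y using induction_basis with
  | h0 => simp
  | ha u v hu hv => simp only [map_add, LinearMap.add_apply, hu, hv]; abel
  | hs c u hu => simp only [map_smul, LinearMap.smul_apply, hu, smul_add]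
  | hb b =>
  induction z using induction_basis with
  | h0 => simp
  | ha u v hu hv => simp only [map_add, hu, hv]; abel
  | hs c u hu => simp only [map_smul, hu, smul_add]
  | hb c =>
  obtain ⟨a, m⟩ := a
  obtain ⟨b, n⟩ := b
  obtain ⟨c, k⟩ := c
  cases a <;> cases b <;> cases c <;>
    simp only [bracketBilin_basis, bracketGen, map_smul, map_zero, LinearMap.smul_apply,
      LinearMap.zero_apply, L, M, S, I, smul_zero, add_zero, smul_smul,
      add_assoc, add_left_comm n m k, ← add_smul, Int.cast_add] <;>
    first
      | done
      | (congr 1; ring)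

noncomputable instance : LieRing BMSKacMoody where
  bracket x y := bracketBilin x y
  add_lie x y z := by simp
  lie_add x y z := by simp
  lie_self x := by
    have h : (2 : ℂ) • bracketBilin x x = 0 := by
      rw [two_smul]
      exact add_eq_zero_iff_eq_neg.mpr (bracketBilin_antisymm x x)
    exact (smul_eq_zero.mp h).resolve_left two_ne_zero
  leibniz_lie x y z := bracketBilin_leibniz x y z

noncomputable instance : LieAlgebra ℂ BMSKacMoody where
  lie_smul c x y := map_smul (bracketBilin x) c y

theorem lie_basis (x y : BMSGen × ℤ) : ⁅basis x, basis y⁆ = bracketGen x y :=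
  bracketBilin_basis x y

/-- The commutative subalgebra `ℂ L₀ ⊕ ℂ M₀`. -/
noncomputable def cartan : LieSubalgebra ℂ BMSKacMoody where
  __ := Submodule.span ℂ {L 0, M 0}
  lie_mem' := by
    intro x y hx hy
    have h : ⁅x, y⁆ = 0 := by
      simp only [AddSubsemigroup.mem_carrier, AddSubmonoid.mem_toSubsemigroup,
        Submodule.mem_toAddSubmonoid, Submodule.mem_span_pair] at hx hy
      obtain ⟨a, b, rfl⟩ := hx
      obtain ⟨c, d, rfl⟩ := hy
      simp [L, M, lie_basis, bracketGen]
    rw [h]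
    exact Submodule.zero_mem _

/-- The action of `U(ℂ L₀ ⊕ ℂ M₀)` on a module over the BMS-Kac-Moody algebra. -/
noncomputable abbrev cartanModule (V : Type*) [AddCommGroup V] [Module ℂ V]
    [LieRingModule BMSKacMoody V] [LieModule ℂ BMSKacMoody V] :
    Module (UniversalEnvelopingAlgebra ℂ cartan) V :=
  Module.compHom V
    (UniversalEnvelopingAlgebra.lift ℂ (LieModule.toEnd ℂ cartan V)).toRingHom

/-- The restriction of `V` to `U(ℂ L₀ ⊕ ℂ M₀)` is free of rank one: it has a basis with exactly
one element. -/
def IsCartanFreeOfRankOne (V : Type*) [AddCommGroup V] [Module ℂ V]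
    [LieRingModule BMSKacMoody V] [LieModule ℂ BMSKacMoody V] : Prop :=
  letI := cartanModule V
  Nonempty (Module.Basis Unit (UniversalEnvelopingAlgebra ℂ cartan) V)

end BMSKacMoody

open BMSKacMoody

namespace BMSPhi

open MvPolynomial

/-- The variable `s` of `ℂ[s, t]`. -/
noncomputable abbrev s : MvPolynomial (Fin 2) ℂ := X 0

/-- The variable `t` of `ℂ[s, t]`. -/
noncomputable abbrev t : MvPolynomial (Fin 2) ℂ := X 1

/-- A polynomial in one variable as the element `p(t)` of `ℂ[s, t]`. -/
noncomputable def inT (p : Polynomial ℂ) : MvPolynomial (Fin 2) ℂ := Polynomial.aeval t p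

/-- The substitution `f(s, t) ↦ f(s - m, t)`. -/
noncomputable def shift (m : ℤ) : MvPolynomial (Fin 2) ℂ →ₐ[ℂ] MvPolynomial (Fin 2) ℂ :=
  aeval ![s - C (m : ℂ), t]

/-- The partial derivative `∂/∂t` of `ℂ[s, t]`. -/
noncomputable def dt : MvPolynomial (Fin 2) ℂ →ₗ[ℂ] MvPolynomial (Fin 2) ℂ :=
  (pderiv (1 : Fin 2)).toLinearMap

/-- The polynomial `(h(t) - h(α)) / (t - α)` (the division is exact). -/
noncomputable def quot (α : ℂ) (h : Polynomial ℂ) : Polynomial ℂ :=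
  (h - Polynomial.C (h.eval α)) /ₘ (Polynomial.X - Polynomial.C α)

theorem mul_quot (α : ℂ) (h : Polynomial ℂ) :
    (Polynomial.X - Polynomial.C α) * quot α h = h - Polynomial.C (h.eval α) :=
  Polynomial.mul_divByMonic_eq_iff_isRoot.mpr (by simp)

/-- `h_m(t) = m h(t) - m (m - 1) α (h(t) - h(α)) / (t - α)`. -/
noncomputable def hPoly (α : ℂ) (h : Polynomial ℂ) (m : ℤ) : Polynomial ℂ :=
  Polynomial.C (m : ℂ) * h - Polynomial.C ((m : ℂ) * (m - 1) * α) * quot α h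

/-- The action of `L m`, `M m`, `S m` and `I m` on `ℂ[s, t]`. -/
noncomputable def act (lam : ℂˣ) (α β γ : ℂ) (h : Polynomial ℂ) :
    BMSGen × ℤ → MvPolynomial (Fin 2) ℂ → MvPolynomial (Fin 2) ℂ
  | (.L, m), f => C ((lam : ℂ) ^ m) * (s + inT (hPoly α h m)) * shift m f
      - C ((m : ℂ) * (lam : ℂ) ^ m) * (t - C ((m : ℂ) * α)) * dt (shift m f)
  | (.M, m), f => C ((lam : ℂ) ^ m) * (t - C ((m : ℂ) * α)) * shift m f
  | (.S, m), f => C ((lam : ℂ) ^ m * β) * shift m f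
  | (.I, m), f => C ((lam : ℂ) ^ m) * (C γ - C ((m : ℂ) * β) * inT (quot α h)) * shift m f
      + C ((m : ℂ) * (lam : ℂ) ^ m * β) * dt (shift m f)

theorem act_add (lam : ℂˣ) (α β γ : ℂ) (h : Polynomial ℂ) (i : BMSGen × ℤ)
    (f g : MvPolynomial (Fin 2) ℂ) :
    act lam α β γ h i (f + g) = act lam α β γ h i f + act lam α β γ h i g := by
  obtain ⟨a, m⟩ := i
  cases a <;> simp only [act, map_add] <;> ring

theorem act_smul (lam : ℂˣ) (α β γ : ℂ) (h : Polynomial ℂ) (i : BMSGen × ℤ)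
    (c : ℂ) (f : MvPolynomial (Fin 2) ℂ) :
    act lam α β γ h i (c • f) = c • act lam α β γ h i f := by
  obtain ⟨a, m⟩ := i
  cases a <;> simp only [act, map_smul, mul_smul_comm, smul_sub, smul_add]

/-- The action on `ℂ[s, t]`, extended linearly to the whole algebra. -/
noncomputable def rho (lam : ℂˣ) (α β γ : ℂ) (h : Polynomial ℂ) :
    BMSKacMoody →ₗ[ℂ] MvPolynomial (Fin 2) ℂ →ₗ[ℂ] MvPolynomial (Fin 2) ℂ :=
  BMSKacMoody.basis.constr ℂ fun i =>
    { toFun := act lam α β γ h i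
      map_add' := act_add lam α β γ h i
      map_smul' := act_smul lam α β γ h i }

theorem rho_basis (lam : ℂˣ) (α β γ : ℂ) (h : Polynomial ℂ) (i : BMSGen × ℤ)
    (f : MvPolynomial (Fin 2) ℂ) :
    rho lam α β γ h (BMSKacMoody.basis i) f = act lam α β γ h i f := by
  simp [rho]

theorem shift_inT (m : ℤ) (p : Polynomial ℂ) : shift m (inT p) = inT p := by
  rw [inT, ← Polynomial.aeval_algHom_apply]
  simp [shift]

theorem shift_s (m : ℤ) : shift m s = s - C (m : ℂ) := by simp [shift]

theorem shift_t (m : ℤ) : shift m t = t := by simp [shift]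

theorem shift_C (m : ℤ) (c : ℂ) : shift m (C c) = C c := by simp [shift, algebraMap_eq]

theorem shift_shift (m n : ℤ) (f : MvPolynomial (Fin 2) ℂ) :
    shift m (shift n f) = shift (m + n) f := by
  have h : (shift m).comp (shift n) = shift (m + n) := by
    ext i
    fin_cases i
    · simp [shift]; ring
    · simp [shift]
  exact congrArg (fun g => g f) h

theorem dt_mul (f g : MvPolynomial (Fin 2) ℂ) : dt (f * g) = dt f * g + f * dt g := by
  simp only [dt, Derivation.coeFn_coe, Derivation.leibniz,
    smul_eq_mul]
  ring

theorem dt_s : dt s = 0 := by simp [dt, pderiv_X]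

theorem dt_t : dt t = 1 := by simp [dt]

theorem dt_C (c : ℂ) : dt (C c) = 0 := by simp [dt]

theorem dt_shift (m : ℤ) (f : MvPolynomial (Fin 2) ℂ) : dt (shift m f) = shift m (dt f) := by
  induction f using MvPolynomial.induction_on with
  | C a => simp [dt_C]
  | add p q hp hq => simp only [map_add, hp, hq]
  | mul_X p i hp =>
    rw [map_mul, dt_mul, dt_mul, map_add, map_mul, map_mul, hp]
    fin_cases i
    · simp only [Fin.zero_eta, shift_s, dt_s, map_sub, dt_C, sub_zero, map_zero]
    · simp only [Fin.mk_one, shift_t, dt_t, map_one]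

theorem inT_hPoly (α : ℂ) (h : Polynomial ℂ) (m : ℤ) :
    inT (hPoly α h m) = C (m : ℂ) * C (h.eval α)
      + C (m : ℂ) * (t - C (m : ℂ) * C α) * inT (quot α h) := by
  have h1 := congrArg inT (mul_quot α h)
  simp only [inT, map_mul, map_sub, Polynomial.aeval_X, Polynomial.aeval_C, algebraMap_eq] at h1
  simp only [hPoly, inT, map_mul, map_sub, Polynomial.aeval_C, algebraMap_eq, map_one]
  linear_combination (-C (m : ℂ)) * h1

theorem rho_lie (lam : ℂˣ) (α β γ : ℂ) (h : Polynomial ℂ) (x y : BMSKacMoody)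
    (f : MvPolynomial (Fin 2) ℂ) :
    rho lam α β γ h ⁅x, y⁆ f =
      rho lam α β γ h x (rho lam α β γ h y f) - rho lam α β γ h y (rho lam α β γ h x f) := by
  induction x using induction_basis with
  | h0 => simp
  | ha u v hu hv => simp only [add_lie, map_add, LinearMap.add_apply, hu, hv]; abel
  | hs c u hu => simp only [smul_lie, map_smul, LinearMap.smul_apply, hu, smul_sub]
  | hb a =>
  induction y using induction_basis with
  | h0 => simp
  | ha u v hu hv => simp only [lie_add, map_add, LinearMap.add_apply, hu, hv]; abel
  | hs c u hu => simp only [lie_smul, map_smul, LinearMap.smul_apply, hu, smul_sub]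
  | hb b =>
  obtain ⟨a, m⟩ := a
  obtain ⟨b, n⟩ := b
  have hl : (lam : ℂ) ^ (m + n) = (lam : ℂ) ^ m * (lam : ℂ) ^ n := zpow_add₀ lam.ne_zero m n
  cases a <;> cases b <;>
    simp only [lie_basis, bracketGen, BMSKacMoody.L, BMSKacMoody.M, BMSKacMoody.S,
      BMSKacMoody.I, map_smul, map_zero, LinearMap.smul_apply, LinearMap.zero_apply,
      rho_basis, act, inT_hPoly, map_add, map_sub, map_mul, map_neg, shift_shift, shift_inT, shift_s,
      shift_t, shift_C, dt_mul, dt_s, dt_t, dt_C, dt_shift, hl, smul_eq_C_mul, add_comm n m,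
      Int.cast_add] <;>
    ring

end BMSPhi

/-- The module `Φ(λ, α, β, γ, h(t))`, with underlying space `ℂ[s, t]`. -/
def BMSPhi (_lam : ℂˣ) (_α _β _γ : ℂ) (_h : Polynomial ℂ) : Type := MvPolynomial (Fin 2) ℂ

namespace BMSPhi

noncomputable instance (lam : ℂˣ) (α β γ : ℂ) (h : Polynomial ℂ) :
    AddCommGroup (BMSPhi lam α β γ h) :=
  inferInstanceAs (AddCommGroup (MvPolynomial (Fin 2) ℂ))

noncomputable instance (lam : ℂˣ) (α β γ : ℂ) (h : Polynomial ℂ) :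
    Module ℂ (BMSPhi lam α β γ h) :=
  inferInstanceAs (Module ℂ (MvPolynomial (Fin 2) ℂ))

noncomputable instance (lam : ℂˣ) (α β γ : ℂ) (h : Polynomial ℂ) :
    LieRingModule BMSKacMoody (BMSPhi lam α β γ h) where
  bracket x f := rho lam α β γ h x f
  add_lie x y f := LinearMap.map_add₂ (rho lam α β γ h) x y f
  lie_add x f g := map_add (rho lam α β γ h x) f g
  leibniz_lie x y f := sub_eq_iff_eq_add.mp (rho_lie lam α β γ h x y f).symm

noncomputable instance (lam : ℂˣ) (α β γ : ℂ) (h : Polynomial ℂ) :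
    LieModule ℂ BMSKacMoody (BMSPhi lam α β γ h) where
  smul_lie c x f := LinearMap.map_smul₂ (rho lam α β γ h) c x f
  lie_smul c x f := map_smul (rho lam α β γ h x) c f

end BMSPhi

/-!
Since `ℂ L₀ ⊕ ℂ M₀` is abelian, its enveloping algebra is `ℂ[s, t]` (`envelopingEquiv`), so a
module that is free of rank one over it is `ℂ[s, t]` itself, with `L₀` and `M₀` acting as the
multiplications by `s` and `t` (`isCartanFreeOfRankOne_iff`). The brackets with `L₀` and `M₀`
show that every operator `L m, M m, S m, I m` is determined by its value at `1`
(`apply_eq_shift_mul`, `apply_eq_shift_mul_add`); what remains is to find these values, and each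
bracket relation becomes an identity between polynomials.

* `[M m, M (-m)] = 0` makes a product of `M m · 1` and `M (-m) · 1`, with shifted arguments,
  periodic in `s`; hence `M m · 1 = b m (t)` does not depend on `s` (`exists_M_one_eq_inT`), and
  `[L m, M m] = 0` then gives `L m · 1 = s (b m)' + q m (t)` (`exists_L_one_eq`).
* `[L m, M n] = (n - m) M (m + n)` says that
  `n (b n) (b m)' - m (b n)' (b m) = (n - m) b (m + n)` with `b 0 = t`. Here
  `(b 1 b (-1))' = 2 t` and `(b 2 b (-1) ^ 2)' = 3 b 1 b (-1)` force `b 1` and `b (-1)` to have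
  degree one, and then `b m = λ ^ m (t - m α)` (`MRecursion.exists_eq`).
* With `L m · 1 = λ ^ m (s + g m (t))`, the bracket `[L m, L n]` gives a linear recursion for `g`.
  The family `h_m` with `h = g 1` is a solution, and a solution with `g 0 = g 1 = 0` vanishes
  (`LRecursion.eq_hPoly`).
* The remaining brackets make `S m · 1 = λ ^ m β`, and reduce `I m · 1` to the same recursion
  (`exists_eq_C_of_recursion`).

The uniqueness in these recursions comes from the injectivity of `p ↦ k p + (t - a) p'` for `k > 0`
(`eq_zero_of_mul_add_X_sub_C_mul_derivative`). Finally, an isomorphism between two of the modules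
`Φ` commutes with `s` and `t`, so it is multiplication by a unit of `ℂ[s, t]`, a nonzero constant
(`rho_one_eq_of_equiv`), and the parameters can be read off from the action on `1`.
-/

/-! ### The enveloping algebra of the Cartan subalgebra -/

section Enveloping

attribute [local instance] LieRing.ofAssociativeRing

namespace UniversalEnvelopingAlgebra

open MvPolynomial

variable {R L : Type*} [CommRing R] [LieRing L] [LieAlgebra R L]

theorem adjoin_range_ι :
    Algebra.adjoin R (Set.range (ι R : L → UniversalEnvelopingAlgebra R L)) = ⊤ := by
  have h1 : Set.range (ι R : L → UniversalEnvelopingAlgebra R L)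
      = mkAlgHom R L '' Set.range (TensorAlgebra.ι R) := by
    rw [← Set.range_comp]; rfl
  rw [h1, ← AlgHom.map_adjoin, TensorAlgebra.adjoin_range_ι, Algebra.map_top,
    AlgHom.range_eq_top]
  exact RingCon.mkₐ_surjective _

theorem ι_mul_comm [IsLieAbelian L] (x y : L) : ι R x * ι R y = ι R y * ι R x := by
  have := (ι R : L →ₗ⁅R⁆ UniversalEnvelopingAlgebra R L).map_lie x y
  rw [trivial_lie_zero, map_zero, LieRing.of_associative_ring_bracket] at this
  exact (sub_eq_zero.mp this.symm)

/-- The universal enveloping algebra of an abelian Lie algebra is commutative. -/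
@[reducible]
def commRing [IsLieAbelian L] : CommRing (UniversalEnvelopingAlgebra R L) where
  mul_comm := by
    have hc : ∀ a ∈ Set.range (ι R : L → UniversalEnvelopingAlgebra R L),
      ∀ b ∈ Set.range (ι R : L → UniversalEnvelopingAlgebra R L), a * b = b * a := by
      rintro _ ⟨x, rfl⟩ _ ⟨y, rfl⟩
      exact ι_mul_comm x y
    have := Algebra.isMulCommutative_adjoin R hc
    intro a b
    have h (a : UniversalEnvelopingAlgebra R L) :
        a ∈ Algebra.adjoin R (Set.range (ι R : L → UniversalEnvelopingAlgebra R L)) := by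
      rw [adjoin_range_ι]; trivial
    exact congrArg Subtype.val 
      (mul_comm' (⟨a, h a⟩ : Algebra.adjoin R (Set.range (ι R))) ⟨b, h b⟩)

/-- The universal enveloping algebra of an abelian Lie algebra with basis indexed by `σ` is the
polynomial algebra in variables indexed by `σ`. -/
noncomputable def equivMvPolynomial {σ : Type*} [IsLieAbelian L] (b : Module.Basis σ R L) :
    UniversalEnvelopingAlgebra R L ≃ₐ[R] MvPolynomial σ R :=
  letI := commRing (R := R) (L := L)
  AlgEquiv.ofAlgHom
    (lift R { b.constr R (X : σ → MvPolynomial σ R) with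
      map_lie' := by
        intro x y
        rw [trivial_lie_zero, LieRing.of_associative_ring_bracket, mul_comm, sub_self]
        exact map_zero (b.constr R (X : σ → MvPolynomial σ R)) })
    (aeval fun i => ι R (b i))
    (by
      ext i
      simp only [AlgHom.comp_apply, aeval_X, AlgHom.id_apply, lift_ι_apply]
      exact congrArg _ (b.constr_basis R _ i))
    (by
      ext x
      simp only [LieHom.comp_apply, AlgHom.coe_toLieHom, AlgHom.comp_apply, AlgHom.id_apply,
        lift_ι_apply]
      have h : (aeval fun i => ι R (b i)).toLinearMap ∘ₗ b.constr R (X : σ → MvPolynomial σ R)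
          = (ι R : L →ₗ⁅R⁆ UniversalEnvelopingAlgebra R L) :=
        b.ext fun i => by simp
      exact LinearMap.congr_fun h x)

theorem equivMvPolynomial_ι {σ : Type*} [IsLieAbelian L] (b : Module.Basis σ R L) (i : σ) :
    equivMvPolynomial b (ι R (b i)) = X i :=
  (lift_ι_apply R _ _).trans (b.constr_basis R _ i)

end UniversalEnvelopingAlgebra

end Enveloping

namespace BMSKacMoody

open MvPolynomial

theorem linearIndependent_L_M : LinearIndependent ℂ ![L 0, M 0] := by
  have := basis.linearIndependent.comp ![(BMSGen.L, (0 : ℤ)), (BMSGen.M, 0)] (by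
    intro i j h
    fin_cases i <;> fin_cases j <;> simp at h ⊢)
  convert this using 1
  ext i
  fin_cases i <;> rfl

/-- The basis `L 0, M 0` of the subalgebra `ℂ L₀ ⊕ ℂ M₀`. -/
noncomputable def cartanBasis : Module.Basis (Fin 2) ℂ cartan :=
  (Module.Basis.span linearIndependent_L_M).map
    (LinearEquiv.ofEq _ cartan.toSubmodule (by
      simp [cartan, Set.pair_comm (M 0)]))

theorem coe_cartanBasis_zero : (cartanBasis 0 : BMSKacMoody) = L 0 := by
  rw [cartanBasis, Module.Basis.map_apply]
  exact congrArg Subtype.val <| Module.Basis.span_apply linearIndependent_L_M 0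

theorem coe_cartanBasis_one : (cartanBasis 1 : BMSKacMoody) = M 0 := by
  rw [cartanBasis, Module.Basis.map_apply]
  exact congrArg Subtype.val <| Module.Basis.span_apply linearIndependent_L_M 1

instance : IsLieAbelian cartan where
  trivial x y := by
    ext
    have h (z : cartan) : ∃ a b : ℂ, a • L 0 + b • M 0 = z := Submodule.mem_span_pair.mp z.2
    obtain ⟨a, b, h1⟩ := h x
    obtain ⟨c, d, h2⟩ := h y
    rw [LieSubalgebra.coe_bracket, ← h1, ← h2]
    simp [L, M, lie_basis, bracketGen]

/-- `U(ℂ L₀ ⊕ ℂ M₀)` is the polynomial algebra `ℂ[s, t]`, with `s = L₀` and `t = M₀`. -/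
noncomputable def envelopingEquiv :
    UniversalEnvelopingAlgebra ℂ cartan ≃ₐ[ℂ] MvPolynomial (Fin 2) ℂ :=
  UniversalEnvelopingAlgebra.equivMvPolynomial cartanBasis

variable (V : Type*) [AddCommGroup V] [Module ℂ V]
    [LieRingModule BMSKacMoody V] [LieModule ℂ BMSKacMoody V]

/-- The action of `ℂ[s, t]`, identified with `U(ℂ L₀ ⊕ ℂ M₀)`, on a module over the
BMS-Kac-Moody algebra. -/
noncomputable def polyAction : MvPolynomial (Fin 2) ℂ →ₐ[ℂ] Module.End ℂ V :=
  (UniversalEnvelopingAlgebra.lift ℂ (LieModule.toEnd ℂ cartan V)).comp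
    (envelopingEquiv.symm : MvPolynomial (Fin 2) ℂ →ₐ[ℂ] _)

theorem polyAction_s (v : V) : polyAction V (X 0) v = ⁅L 0, v⁆ := by
  have h : envelopingEquiv.symm (X 0) = UniversalEnvelopingAlgebra.ι ℂ (cartanBasis 0) :=
    envelopingEquiv.symm_apply_eq.mpr
      (UniversalEnvelopingAlgebra.equivMvPolynomial_ι cartanBasis 0).symm
  rw [polyAction, AlgHom.comp_apply, AlgEquiv.coe_toAlgHom, h,
    UniversalEnvelopingAlgebra.lift_ι_apply, ← coe_cartanBasis_zero]
  rfl

theorem polyAction_t (v : V) : polyAction V (X 1) v = ⁅M 0, v⁆ := by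
  have h : envelopingEquiv.symm (X 1) = UniversalEnvelopingAlgebra.ι ℂ (cartanBasis 1) :=
    envelopingEquiv.symm_apply_eq.mpr
      (UniversalEnvelopingAlgebra.equivMvPolynomial_ι cartanBasis 1).symm
  rw [polyAction, AlgHom.comp_apply, AlgEquiv.coe_toAlgHom, h,
    UniversalEnvelopingAlgebra.lift_ι_apply, ← coe_cartanBasis_one]
  rfl

/-- A module is free of rank one over `U(ℂ L₀ ⊕ ℂ M₀)` exactly if `f ↦ f(L₀, M₀) v` is a
bijection from `ℂ[s, t]` onto it for some vector `v`. -/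
theorem isCartanFreeOfRankOne_iff :
    IsCartanFreeOfRankOne V ↔ ∃ v : V, Function.Bijective fun f => polyAction V f v := by
  let := cartanModule V
  have h (v : V) : (LinearMap.toSpanSingleton (UniversalEnvelopingAlgebra ℂ cartan) V v : _ → V)
      = (fun f => polyAction V f v) ∘ envelopingEquiv := by
    funext u
    simp only [polyAction, Function.comp_apply, AlgHom.comp_apply, AlgEquiv.coe_toAlgHom,
      AlgEquiv.symm_apply_apply]
    rfl
  constructor
  · rintro ⟨b⟩
    refine ⟨b (), (Function.Bijective.of_comp_iff _ envelopingEquiv.bijective).mp ?_⟩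
    rw [← h]
    convert ((LinearEquiv.funUnique Unit (UniversalEnvelopingAlgebra ℂ cartan)
      (UniversalEnvelopingAlgebra ℂ cartan)).symm.trans b.equivFun.symm).bijective using 1
    funext u
    simp [Module.Basis.equivFun_symm_apply]
  · rintro ⟨v, hv⟩
    have hb : Function.Bijective
        (LinearMap.toSpanSingleton (UniversalEnvelopingAlgebra ℂ cartan) V v) := by
      rw [h]
      exact hv.comp envelopingEquiv.bijective
    exact ⟨Module.Basis.ofEquivFun ((LinearEquiv.ofBijective _ hb).symm.trans
      (LinearEquiv.funUnique Unit (UniversalEnvelopingAlgebra ℂ cartan)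
        (UniversalEnvelopingAlgebra ℂ cartan)).symm)⟩

end BMSKacMoody

/-! ### Recursions for polynomials in one variable -/

namespace BMSPhi

section OneVariable

open Polynomial

/-- The differential operator `p ↦ k p + (X - a) p'` is injective for `k > 0`: if it kills `p`, then
`(X - a) ^ k p` is constant, and it vanishes at `a`. -/
theorem eq_zero_of_mul_add_X_sub_C_mul_derivative {k : ℕ} (hk : 0 < k) {a : ℂ} {p : ℂ[X]}
    (h : (k : ℂ[X]) * p + (X - C a) * derivative p = 0) : p = 0 := by
  have h1 : derivative ((X - C a) ^ k * p) = 0 := by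
    obtain ⟨j, rfl⟩ := Nat.exists_eq_succ_of_ne_zero hk.ne'
    simp only [derivative_mul, derivative_X_sub_C_pow, map_natCast, Nat.succ_sub_one]
    push_cast at h ⊢
    rw [pow_succ]
    linear_combination (X - C a) ^ j * h
  have h2 := eq_C_of_derivative_eq_zero h1
  have h3 : (X - C a) ^ k * p = 0 := by
    have h4 := congrArg (eval a) h2
    rw [eval_C, eval_mul, eval_pow, eval_sub, eval_X, eval_C, sub_self, zero_pow hk.ne',
      zero_mul] at h4
    rw [h2, ← h4, C_0]
  exact (mul_eq_zero.mp h3).resolve_left (pow_ne_zero _ (X_sub_C_ne_zero a))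

/-- The recursion that the bracket `[L m, M n] = (n - m) M (m + n)` imposes on the polynomials
`b m = M m · 1`; it is preserved by `b ↦ (m ↦ b (-m))`. -/
def MRecursion (b : ℤ → ℂ[X]) : Prop :=
  ∀ m n : ℤ, (n : ℂ[X]) * b n * derivative (b m) - (m : ℂ[X]) * derivative (b n) * b m
    = ((n : ℂ[X]) - m) * b (m + n)

theorem MRecursion.neg {b : ℤ → ℂ[X]} (h : MRecursion b) : MRecursion fun m => b (-m) := by
  intro m n
  have := h (-m) (-n)
  rw [← neg_add] at this
  push_cast at this
  linear_combination -this

theorem MRecursion.derivative_mul_neg {b : ℤ → ℂ[X]} (h : MRecursion b) (h0 : b 0 = X) :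
    derivative (b 1 * b (-1)) = derivative (X ^ 2) := by
  have h1 := h 1 (-1)
  simp only [Int.reduceNeg, Int.cast_neg, Int.cast_one, add_neg_cancel, h0] at h1
  simp only [Int.reduceNeg, derivative_mul, derivative_X_pow, Nat.cast_ofNat, map_ofNat,
    Nat.add_one_sub_one, pow_one]
  linear_combination -h1

theorem exists_eq_add_C_of_derivative_eq {p q : ℂ[X]} (h : derivative p = derivative q) :
    ∃ c, p = q + C c := by
  have := eq_C_of_derivative_eq_zero (p := p - q) (by rw [derivative_sub, h, sub_self])
  exact ⟨_, by rw [← this]; ring⟩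

/-- `(b 2 * (b (-1)) ^ 2)' = 3 b 1 b (-1)` is a quadratic polynomial, so `b 2 * (b (-1)) ^ 2`
is a cubic one. -/
theorem MRecursion.natDegree_neg_one_le {b : ℤ → ℂ[X]} (h : MRecursion b) (h0 : b 0 = X)
    (hb : ∀ m, b m ≠ 0) : (b (-1)).natDegree ≤ 1 := by
  obtain ⟨c, hc⟩ := exists_eq_add_C_of_derivative_eq (h.derivative_mul_neg h0)
  have h1 := h (-1) 2
  have h2 : derivative (b 2 * b (-1) ^ 2) = derivative (X ^ 3 + C (3 * c) * X) := by
    simp only [Int.reduceNeg, Int.cast_neg, Int.cast_one, Int.cast_ofNat, Int.reduceAdd] at h1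
    simp only [Int.reduceNeg, derivative_mul, derivative_pow, derivative_add, derivative_X,
      derivative_C, map_mul, map_ofNat, Nat.cast_ofNat, Nat.add_one_sub_one, pow_one,
      derivative_ofNat]
    linear_combination b (-1) * h1 + 3 * hc
  obtain ⟨d, hd⟩ := exists_eq_add_C_of_derivative_eq h2
  have h3 : (X ^ 3 + C (3 * c) * X + C d : ℂ[X]).natDegree = 3 := by compute_degree!
  rw [← hd, natDegree_mul (hb _) (pow_ne_zero _ (hb _)), natDegree_pow] at h3
  omega

theorem MRecursion.exists_eq_one {b : ℤ → ℂ[X]} (h : MRecursion b) (h0 : b 0 = X)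
    (hb : ∀ m, b m ≠ 0) : ∃ (lam : ℂˣ) (α : ℂ),
      b 1 = C (lam : ℂ) * (X - C α) ∧ b (-1) = C ((lam⁻¹ : ℂˣ) : ℂ) * (X + C α) := by
  obtain ⟨c, hc⟩ := exists_eq_add_C_of_derivative_eq (h.derivative_mul_neg h0)
  obtain ⟨u, v, h1⟩ := exists_eq_X_add_C_of_natDegree_le_one
    (show (b 1).natDegree ≤ 1 by
      simpa using h.neg.natDegree_neg_one_le (by simpa) (fun m => hb _))
  obtain ⟨u', v', h2⟩ := exists_eq_X_add_C_of_natDegree_le_one (h.natDegree_neg_one_le h0 hb)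
  rw [h1, h2] at hc
  have e : C (u * u') * X ^ 2 + C (u * v' + v * u') * X + C (v * v') = X ^ 2 + C c := by
    rw [← hc]; simp only [map_add, map_mul]; ring
  have e2 : u * u' = 1 := by
    simpa [coeff_X, coeff_C, -map_mul] using congrArg (fun p => coeff p 2) e
  have e1 : u * v' + v * u' = 0 := by
    simpa [coeff_X, coeff_C, coeff_X_pow, -map_mul] using congrArg (fun p => coeff p 1) e
  have hu : u ≠ 0 := left_ne_zero_of_mul_eq_one e2
  refine ⟨⟨u, u', e2, by rw [mul_comm, e2]⟩, -(u' * v), ?_, ?_⟩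
  · rw [h1]
    have : v = u * (u' * v) := by linear_combination (-v) * e2
    simp only [map_neg, sub_neg_eq_add, mul_add, ← map_mul, ← this]
  · rw [h2]
    have : v' = u' * -(u' * v) := by linear_combination u' * e1 - v' * e2
    simp only [Units.inv_mk, mul_add, ← map_mul, ← this]

theorem MRecursion.eq_natCast {b : ℤ → ℂ[X]} (h : MRecursion b) (h0 : b 0 = X) {lam : ℂˣ} {α : ℂ}
    (h1 : b 1 = C (lam : ℂ) * (X - C α)) (h2 : b (-1) = C ((lam⁻¹ : ℂˣ) : ℂ) * (X + C α))
    (m : ℕ) : b m = C ((lam : ℂ) ^ m) * (X - C (m * α)) := by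
  have hl : C (lam : ℂ) * C ((lam⁻¹ : ℂˣ) : ℂ) = 1 := by rw [← C_mul]; simp
  match m with
  | 0 => simp [h0]
  | 1 => simp [h1]
  | m + 2 =>
  induction m with
  | zero =>
    -- The relation for `(1, 1)` is trivial, so `b 2` has to be found from the one for `(-1, 2)`,
    -- which is a first-order differential equation for `b 2`.
    have h3 := h (-1) 2
    rw [← sub_eq_zero]
    apply eq_zero_of_mul_add_X_sub_C_mul_derivative (k := 2) (by norm_num) (a := -α)
    simp only [Int.reduceNeg, Int.cast_neg, Int.cast_one, Int.cast_ofNat, Int.reduceAdd, h1, h2,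
      derivative_mul, derivative_add, derivative_X, derivative_C] at h3
    simp only [Nat.zero_add, Nat.cast_ofNat, map_neg, map_mul, map_pow, map_ofNat, map_sub,
      derivative_mul, derivative_X, derivative_C, derivative_pow, derivative_ofNat]
    linear_combination C (lam : ℂ) * h3 - (2 * b 2 + derivative (b 2) * (X + C α)) * hl
  | succ m ih =>
    have h3 := h 1 ((m + 2 : ℕ) : ℤ)
    rw [ih, h1] at h3
    have hm : ((m : ℂ[X]) + 1) ≠ 0 := by exact_mod_cast Nat.succ_ne_zero m
    apply mul_left_cancel₀ hm
    rw [show (1 + ((m + 2 : ℕ) : ℤ)) = ((m + 1 + 2 : ℕ) : ℤ) by push_cast; ring] at h3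
    simp only [Int.cast_one, Int.cast_natCast, derivative_mul, derivative_sub, derivative_X,
      derivative_C] at h3
    simp only [map_mul, map_pow, map_natCast] at h3 ⊢
    push_cast at h3 ⊢
    linear_combination -h3

theorem MRecursion.exists_eq {b : ℤ → ℂ[X]} (h : MRecursion b) (h0 : b 0 = X)
    (hb : ∀ m, b m ≠ 0) : ∃ (lam : ℂˣ) (α : ℂ), ∀ m : ℤ,
      b m = C ((lam : ℂ) ^ m) * (X - C (m * α)) := by
  obtain ⟨lam, α, h1, h2⟩ := h.exists_eq_one h0 hb
  refine ⟨lam, α, fun m => ?_⟩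
  obtain ⟨n, rfl | rfl⟩ := m.eq_nat_or_neg
  · simpa using h.eq_natCast h0 h1 h2 n
  · have := h.neg.eq_natCast (lam := lam⁻¹) (α := -α) (by simpa) (by simpa using h2)
      (by simpa [← sub_eq_add_neg] using h1) n
    simpa using this

/-- The recursion that the bracket `[L m, L n] = (n - m) L (m + n)` imposes on the polynomials
`g m` with `L m · 1 = λ ^ m (s + g m)`. It is linear in `g`, and preserved by replacing `g` by
`m ↦ g (-m)` and `α` by `-α`. -/
def LRecursion (α : ℂ) (g : ℤ → ℂ[X]) : Prop :=
  ∀ m n : ℤ, (n : ℂ[X]) * g n - (m : ℂ[X]) * g m - (m : ℂ[X]) * (X - C (m * α)) * derivative (g n)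
    + (n : ℂ[X]) * (X - C (n * α)) * derivative (g m) = ((n : ℂ[X]) - (m : ℂ[X])) * g (m + n)

theorem LRecursion.neg {α : ℂ} {g : ℤ → ℂ[X]} (h : LRecursion α g) :
    LRecursion (-α) fun m => g (-m) := by
  intro m n
  have := h (-m) (-n)
  rw [← neg_add] at this
  push_cast at this
  simp only [map_neg, map_mul, neg_mul, mul_neg] at this ⊢
  linear_combination -this

theorem LRecursion.sub {α : ℂ} {g g' : ℤ → ℂ[X]} (h : LRecursion α g) (h' : LRecursion α g') :
    LRecursion α fun m => g m - g' m := by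
  intro m n
  simp only [derivative_sub]
  linear_combination h m n - h' m n

theorem LRecursion.eq_zero_natCast {α : ℂ} {g : ℤ → ℂ[X]} (h : LRecursion α g) (h0 : g 0 = 0)
    (h1 : g 1 = 0) (h2 : g (-1) = 0) (m : ℕ) : g m = 0 := by
  match m with
  | 0 => simpa
  | 1 => simpa
  | m + 2 =>
  induction m with
  | zero =>
    -- The relation for `(1, 1)` is trivial, so `g 2` has to be found from the one for `(-1, 2)`.
    have h3 := h (-1) 2
    apply eq_zero_of_mul_add_X_sub_C_mul_derivative (k := 2) (by norm_num) (a := -α)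
    simp only [Int.reduceNeg, Int.cast_neg, Int.cast_one, Int.cast_ofNat, Int.reduceAdd,
      h1, h2, derivative_zero, C_mul, C_neg, C_1] at h3
    simp only [Nat.zero_add, Nat.cast_ofNat, C_neg]
    linear_combination h3
  | succ m ih =>
    have h3 := h 1 ((m + 2 : ℕ) : ℤ)
    rw [ih, h1, show (1 + ((m + 2 : ℕ) : ℤ)) = ((m + 1 + 2 : ℕ) : ℤ) by push_cast; ring] at h3
    have hm : ((m : ℂ[X]) + 1) ≠ 0 := by exact_mod_cast Nat.succ_ne_zero m
    apply mul_left_cancel₀ hm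
    simp only [Int.cast_one, Int.cast_natCast, derivative_zero] at h3
    push_cast at h3 ⊢
    linear_combination -h3

theorem LRecursion.eq_zero {α : ℂ} {g : ℤ → ℂ[X]} (h : LRecursion α g) (h0 : g 0 = 0)
    (h1 : g 1 = 0) (m : ℤ) : g m = 0 := by
  have h2 : g (-1) = 0 := by
    have h3 := h (-1) 1
    apply eq_zero_of_mul_add_X_sub_C_mul_derivative (k := 1) (by norm_num) (a := α)
    simp only [Int.reduceNeg, Int.cast_neg, Int.cast_one, Int.reduceAdd, h0, h1,
      derivative_zero, C_mul, C_1] at h3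
    push_cast
    linear_combination h3
  obtain ⟨n, rfl | rfl⟩ := m.eq_nat_or_neg
  · exact h.eq_zero_natCast h0 h1 h2 n
  · exact h.neg.eq_zero_natCast (by simpa) (by simpa) (by simpa) n

theorem hPoly_eq (α : ℂ) (h : ℂ[X]) (m : ℤ) :
    hPoly α h m = (m : ℂ[X]) * C (h.eval α) + (m : ℂ[X]) * (X - C (m * α)) * quot α h := by
  simp only [hPoly, map_mul, map_sub, map_intCast, map_one]
  linear_combination (-(m : ℂ[X])) * mul_quot α h

theorem hPoly_one (α : ℂ) (h : ℂ[X]) : hPoly α h 1 = h := by simp [hPoly]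

theorem lRecursion_hPoly (α : ℂ) (h : ℂ[X]) : LRecursion α (hPoly α h) := by
  intro m n
  simp only [hPoly_eq, derivative_sub, derivative_mul, derivative_X, derivative_C,
    derivative_intCast, map_mul, map_add, map_intCast, Int.cast_add]
  ring

theorem LRecursion.eq_hPoly {α : ℂ} {g : ℤ → ℂ[X]} (h : LRecursion α g) (h0 : g 0 = 0) (m : ℤ) :
    g m = hPoly α (g 1) m :=
  sub_eq_zero.mp ((h.sub (lRecursion_hPoly α (g 1))).eq_zero (by simp [h0, hPoly])
    (by simp [hPoly_one]) m)

/-- The recursion that the bracket `[L m, S n] = n S (m + n)` imposes on the polynomials `e n`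
with `S n · 1 = λ ^ n (e n)` forces all `e n` to be the same constant: `e 0` is constant by the
relation for `(1, 0)`, and the relation for `(-n, n)` compares `e n` with `e 0`. -/
theorem exists_eq_C_of_recursion {α : ℂ} {e : ℤ → ℂ[X]}
    (h : ∀ m n : ℤ, (n : ℂ[X]) * e n - (m : ℂ[X]) * (X - C (m * α)) * derivative (e n)
      = (n : ℂ[X]) * e (m + n)) :
    ∃ β, ∀ n, e n = C β := by
  have h0 : derivative (e 0) = 0 := by
    have := h 1 0
    simp only [Int.cast_zero, Int.cast_one, zero_mul, one_mul, zero_sub, neg_eq_zero] at this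
    exact (mul_eq_zero.mp this).resolve_left (X_sub_C_ne_zero α)
  obtain ⟨β, h1⟩ : ∃ β, e 0 = C β := ⟨_, eq_C_of_derivative_eq_zero h0⟩
  refine ⟨β, fun n => ?_⟩
  by_cases hn : n = 0
  · rw [hn]; exact h1
  have hn' : (n : ℂ[X]) ≠ 0 := by exact_mod_cast hn
  rw [← sub_eq_zero]
  apply eq_zero_of_mul_add_X_sub_C_mul_derivative (k := 1) (by norm_num) (a := -(n * α))
  apply mul_left_cancel₀ hn'
  have h2 := h (-n) n
  simp only [neg_add_cancel, h1] at h2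
  simp only [map_neg, map_mul, map_intCast, Int.cast_neg] at h2
  simp only [map_neg, map_mul, map_intCast, derivative_sub, derivative_C, Nat.cast_one]
  linear_combination h2

end OneVariable

end BMSPhi

/-! ### Polynomial representations -/

namespace BMSPhi

open MvPolynomial

/-- `ℂ[s, t]` as the polynomial ring in `s` over `ℂ[t]`. -/
noncomputable def toPolyS : MvPolynomial (Fin 2) ℂ →ₐ[ℂ] Polynomial (Polynomial ℂ) :=
  aeval ![Polynomial.X, Polynomial.C Polynomial.X]

theorem toPolyS_s : toPolyS s = Polynomial.X := by simp [toPolyS]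

theorem toPolyS_t : toPolyS t = Polynomial.C Polynomial.X := by simp [toPolyS]

theorem toPolyS_inT (p : Polynomial ℂ) : toPolyS (inT p) = Polynomial.C p := by
  have h : toPolyS.comp (Polynomial.aeval t) = (Polynomial.CAlgHom : Polynomial ℂ →ₐ[ℂ] _) := by
    ext
    simp [toPolyS_t]
  exact DFunLike.congr_fun h p

theorem inT_injective : Function.Injective inT := fun p q h =>
  Polynomial.C_injective (by rw [← toPolyS_inT, ← toPolyS_inT, h])

theorem eval₂_toPolyS (f : MvPolynomial (Fin 2) ℂ) :
    (toPolyS f).eval₂ (Polynomial.aeval t : Polynomial ℂ →ₐ[ℂ] _).toRingHom s = f := by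
  induction f using MvPolynomial.induction_on with
  | C a =>
    rw [← algebraMap_eq, AlgHom.commutes]
    simp [Polynomial.algebraMap_apply]
  | add p q hp hq => rw [map_add, Polynomial.eval₂_add, hp, hq]
  | mul_X p i hp =>
    rw [map_mul, Polynomial.eval₂_mul, hp]
    fin_cases i
    · simp [toPolyS_s]
    · simp [toPolyS_t]

theorem eq_inT_of_toPolyS_eq_C {f : MvPolynomial (Fin 2) ℂ} {p : Polynomial ℂ}
    (h : toPolyS f = Polynomial.C p) : f = inT p := by
  rw [← eval₂_toPolyS f, h, Polynomial.eval₂_C]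
  rfl

theorem toPolyS_shift (m : ℤ) (f : MvPolynomial (Fin 2) ℂ) :
    toPolyS (shift m f) = (toPolyS f).comp (Polynomial.X - (m : Polynomial (Polynomial ℂ))) := by
  induction f using MvPolynomial.induction_on with
  | C a =>
    rw [shift_C, ← algebraMap_eq, AlgHom.commutes]
    simp [Polynomial.algebraMap_apply]
  | add p q hp hq => simp only [map_add, hp, hq, Polynomial.add_comp]
  | mul_X p i hp =>
    rw [map_mul, map_mul, map_mul, hp, Polynomial.mul_comp]
    fin_cases i
    · simp [shift_s, toPolyS_s]
    · simp [shift_t, toPolyS_t]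

/-- A polynomial in `s` that is periodic in `s` does not depend on `s`. -/
theorem exists_eq_inT_of_shift_eq {m : ℤ} (hm : m ≠ 0) {f : MvPolynomial (Fin 2) ℂ}
    (h : shift m f = f) : ∃ p, f = inT p := by
  refine ⟨(toPolyS f).eval 0, eq_inT_of_toPolyS_eq_C ?_⟩
  have hk (k : ℕ) : (toPolyS f).eval (((-m * k : ℤ)) : Polynomial ℂ) = (toPolyS f).eval 0 := by
    induction k with
    | zero => simp
    | succ k ih =>
      rw [← ih]
      nth_rw 2 [← h]
      rw [toPolyS_shift, Polynomial.eval_comp]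
      congr 1
      simp
      ring
  refine Polynomial.eq_of_infinite_eval_eq _ _ (Set.Infinite.mono ?_
    (Set.infinite_range_of_injective
      (f := fun k : ℕ => (((-m * k : ℤ)) : Polynomial ℂ)) ?_))
  · rintro _ ⟨k, rfl⟩
    simp only [Set.mem_ofPred_eq, hk, Polynomial.eval_C]
  · intro k l hkl
    have := Int.cast_injective hkl
    simpa [hm] using this

/-- A factor of a polynomial of degree zero in `s` has degree zero in `s`. -/
theorem exists_eq_inT_of_mul_eq_inT {f g : MvPolynomial (Fin 2) ℂ} (hg : g ≠ 0) {p : Polynomial ℂ}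
    (h : f * g = inT p) : ∃ q, f = inT q := by
  by_cases hf : f = 0
  · exact ⟨0, by simp [hf, inT]⟩
  have hne {u : MvPolynomial (Fin 2) ℂ} (hu : u ≠ 0) : toPolyS u ≠ 0 := by
    intro h0
    apply hu
    rw [← eval₂_toPolyS u, h0, Polynomial.eval₂_zero]
  have h1 := congrArg (fun u => (toPolyS u).natDegree) h
  simp only [map_mul, toPolyS_inT, Polynomial.natDegree_C,
    Polynomial.natDegree_mul (hne hf) (hne hg)] at h1
  exact ⟨_, eq_inT_of_toPolyS_eq_C (Polynomial.eq_C_of_natDegree_eq_zero (by omega))⟩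

theorem dt_inT (p : Polynomial ℂ) : dt (inT p) = inT (Polynomial.derivative p) := by
  simp only [inT, dt, Derivation.coeFn_coe, Derivation.map_aeval, pderiv_X_self, smul_eq_mul,
    mul_one]

theorem dt_intCast (m : ℤ) : dt (m : MvPolynomial (Fin 2) ℂ) = 0 := by
  rw [← map_intCast (C : ℂ →+* MvPolynomial (Fin 2) ℂ), dt_C]

theorem inT_add (p q : Polynomial ℂ) : inT (p + q) = inT p + inT q := map_add _ p q
theorem inT_sub (p q : Polynomial ℂ) : inT (p - q) = inT p - inT q := map_sub _ p q
theorem inT_mul (p q : Polynomial ℂ) : inT (p * q) = inT p * inT q := map_mul _ p q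
theorem inT_intCast (m : ℤ) : inT m = m := map_intCast (Polynomial.aeval t) m
theorem inT_C (c : ℂ) : inT (Polynomial.C c) = C c := Polynomial.aeval_C t c
theorem inT_X : inT Polynomial.X = t := Polynomial.aeval_X t
theorem inT_zero : inT 0 = 0 := map_zero (Polynomial.aeval t)

/-- An operator that commutes with `t` and satisfies `T s = (s - m) T` is determined by `T 1`. -/
theorem apply_eq_shift_mul {T : MvPolynomial (Fin 2) ℂ →ₗ[ℂ] MvPolynomial (Fin 2) ℂ} {m : ℤ}
    (hs : ∀ f, T (s * f) = (s - (m : MvPolynomial (Fin 2) ℂ)) * T f)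
    (ht : ∀ f, T (t * f) = t * T f) (f : MvPolynomial (Fin 2) ℂ) :
    T f = shift m f * T 1 := by
  induction f using MvPolynomial.induction_on with
  | C a => rw [shift_C, ← smul_eq_C_mul, ← map_smul, smul_eq_C_mul, mul_one]
  | add p q hp hq => rw [map_add, map_add, hp, hq, add_mul]
  | mul_X p i hp =>
    rw [mul_comm p, map_mul (shift m)]
    fin_cases i
    · simp only [Fin.zero_eta, hs, hp, shift_s, map_intCast]; ring
    · simp only [Fin.mk_one, ht, hp, shift_t]; ring

/-- An operator with `T s = (s - m) T` whose commutator with `t` is an operator `D` as in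
`apply_eq_shift_mul` is determined by `T 1` and `D 1`. -/
theorem apply_eq_shift_mul_add {T D : MvPolynomial (Fin 2) ℂ →ₗ[ℂ] MvPolynomial (Fin 2) ℂ} {m : ℤ}
    (hs : ∀ f, T (s * f) = (s - (m : MvPolynomial (Fin 2) ℂ)) * T f)
    (ht : ∀ f, T (t * f) = t * T f + D f) (hD : ∀ f, D f = shift m f * D 1)
    (f : MvPolynomial (Fin 2) ℂ) :
    T f = shift m f * T 1 + dt (shift m f) * D 1 := by
  induction f using MvPolynomial.induction_on with
  | C a =>
    rw [shift_C, dt_C, zero_mul, add_zero, ← smul_eq_C_mul, ← map_smul, smul_eq_C_mul, mul_one]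
  | add p q hp hq => rw [map_add, map_add, map_add, hp, hq]; ring
  | mul_X p i hp =>
    rw [mul_comm p, map_mul (shift m), dt_mul]
    fin_cases i
    · simp only [Fin.zero_eta, hs, hp, shift_s, map_sub, dt_s, dt_intCast, map_intCast]; ring
    · simp only [Fin.mk_one, ht, hp, shift_t, dt_t, hD p]; ring

/-- A representation of the BMS-Kac-Moody algebra on `ℂ[s, t]` in which `L₀` and `M₀` act as the
multiplications by `s` and by `t`. -/
structure IsPolynomialRep
    (ρ : BMSKacMoody →ₗ[ℂ] MvPolynomial (Fin 2) ℂ →ₗ[ℂ] MvPolynomial (Fin 2) ℂ) : Prop where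
  lie : ∀ x y f, ρ ⁅x, y⁆ f = ρ x (ρ y f) - ρ y (ρ x f)
  L_zero : ∀ f, ρ (L 0) f = s * f
  M_zero : ∀ f, ρ (M 0) f = t * f

theorem lie_L_L (m n : ℤ) : ⁅L m, L n⁆ = ((n : ℂ) - m) • L (m + n) := lie_basis _ _
theorem lie_L_M (m n : ℤ) : ⁅L m, M n⁆ = ((n : ℂ) - m) • M (m + n) := lie_basis _ _
theorem lie_L_S (m n : ℤ) : ⁅L m, S n⁆ = (n : ℂ) • S (m + n) := lie_basis _ _
theorem lie_L_I (m n : ℤ) : ⁅L m, I n⁆ = (n : ℂ) • I (m + n) := lie_basis _ _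
theorem lie_M_I (m n : ℤ) : ⁅M m, I n⁆ = (-(n : ℂ)) • S (m + n) := lie_basis _ _
theorem lie_M_M (m n : ℤ) : ⁅M m, M n⁆ = 0 := lie_basis _ _
theorem lie_M_S (m n : ℤ) : ⁅M m, S n⁆ = 0 := lie_basis _ _

theorem shift_zero (f : MvPolynomial (Fin 2) ℂ) : shift 0 f = f := by
  have h : shift 0 = AlgHom.id ℂ (MvPolynomial (Fin 2) ℂ) := by
    ext i
    fin_cases i <;> simp [shift]
  exact DFunLike.congr_fun h f

namespace IsPolynomialRep

variable {ρ : BMSKacMoody →ₗ[ℂ] MvPolynomial (Fin 2) ℂ →ₗ[ℂ] MvPolynomial (Fin 2) ℂ}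

theorem M_apply (h : IsPolynomialRep ρ) (m : ℤ) (f : MvPolynomial (Fin 2) ℂ) :
    ρ (M m) f = shift m f * ρ (M m) 1 := by
  refine apply_eq_shift_mul (fun f => ?_) (fun f => ?_) f
  · have := h.lie (L 0) (M m) f
    simp only [lie_L_M, h.L_zero, zero_add, map_smul, LinearMap.smul_apply, smul_eq_C_mul,
      map_sub, map_intCast, Int.cast_zero, C_0] at this
    linear_combination this
  · have := h.lie (M 0) (M m) f
    simp only [lie_M_M, h.M_zero, map_zero, LinearMap.zero_apply] at this
    linear_combination this

theorem S_apply (h : IsPolynomialRep ρ) (m : ℤ) (f : MvPolynomial (Fin 2) ℂ) :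
    ρ (S m) f = shift m f * ρ (S m) 1 := by
  refine apply_eq_shift_mul (fun f => ?_) (fun f => ?_) f
  · have := h.lie (L 0) (S m) f
    simp only [lie_L_S, h.L_zero, zero_add, map_smul, LinearMap.smul_apply, smul_eq_C_mul,
      map_intCast] at this
    linear_combination this
  · have := h.lie (M 0) (S m) f
    simp only [lie_M_S, h.M_zero, map_zero, LinearMap.zero_apply] at this
    linear_combination this

theorem L_apply (h : IsPolynomialRep ρ) (m : ℤ) (f : MvPolynomial (Fin 2) ℂ) :
    ρ (L m) f = shift m f * ρ (L m) 1
      - (m : MvPolynomial (Fin 2) ℂ) * dt (shift m f) * ρ (M m) 1 := by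
  rw [apply_eq_shift_mul_add (T := ρ (L m)) (D := (-(m : ℂ)) • ρ (M m)) (m := m)
    (fun f => ?_) (fun f => ?_) (fun f => ?_) f]
  · simp only [LinearMap.smul_apply, smul_eq_C_mul, map_neg, map_intCast]
    ring
  · have := h.lie (L 0) (L m) f
    simp only [lie_L_L, h.L_zero, zero_add, map_smul, LinearMap.smul_apply, smul_eq_C_mul,
      map_sub, map_intCast, Int.cast_zero, C_0] at this
    linear_combination this
  · have := h.lie (L m) (M 0) f
    simp only [lie_L_M, h.M_zero, add_zero, map_smul, LinearMap.smul_apply, smul_eq_C_mul,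
      map_sub, map_intCast, Int.cast_zero, C_0] at this
    simp only [LinearMap.smul_apply, smul_eq_C_mul, map_neg, map_intCast]
    linear_combination -this
  · rw [LinearMap.smul_apply, h.M_apply m f, LinearMap.smul_apply, mul_smul_comm]

theorem I_apply (h : IsPolynomialRep ρ) (m : ℤ) (f : MvPolynomial (Fin 2) ℂ) :
    ρ (I m) f = shift m f * ρ (I m) 1
      + (m : MvPolynomial (Fin 2) ℂ) * dt (shift m f) * ρ (S m) 1 := by
  rw [apply_eq_shift_mul_add (T := ρ (I m)) (D := (m : ℂ) • ρ (S m)) (m := m)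
    (fun f => ?_) (fun f => ?_) (fun f => ?_) f]
  · simp only [LinearMap.smul_apply, smul_eq_C_mul, map_intCast]
    ring
  · have := h.lie (L 0) (I m) f
    simp only [lie_L_I, h.L_zero, zero_add, map_smul, LinearMap.smul_apply, smul_eq_C_mul,
      map_intCast] at this
    linear_combination this
  · have := h.lie (M 0) (I m) f
    simp only [lie_M_I, h.M_zero, zero_add, map_smul, LinearMap.smul_apply, smul_eq_C_mul,
      map_neg, map_intCast] at this
    simp only [LinearMap.smul_apply, smul_eq_C_mul, map_intCast]
    linear_combination this
  · rw [LinearMap.smul_apply, h.S_apply m f, LinearMap.smul_apply, mul_smul_comm]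

theorem M_one_ne_zero (h : IsPolynomialRep ρ) (m : ℤ) : ρ (M m) 1 ≠ 0 := by
  intro h0
  by_cases hm : m = 0
  · rw [hm, h.M_zero, mul_one] at h0
    exact X_ne_zero _ h0
  -- `[L (-m), M m] = 2 m M 0`, and `M 0` acts by a nonzero polynomial.
  have := h.lie (L (-m)) (M m) 1
  rw [h.M_apply m (ρ (L (-m)) 1), h0, lie_L_M, neg_add_cancel, map_smul, LinearMap.smul_apply,
    h.M_zero, map_zero, mul_zero, sub_zero, smul_eq_zero] at this
  rcases this with h1 | h1
  · apply hm
    push_cast at h1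
    have h2 : (2 : ℂ) * m = 0 := by linear_combination h1
    simpa using h2
  · rw [mul_one] at h1
    exact X_ne_zero _ h1

/-- As `M m` and `M (-m)` commute, `f(s, t) = b m (s + m, t) * b (-m) (s, t)`, where
`b m = M m · 1`, is periodic in `s`. -/
theorem exists_M_one_eq_inT (h : IsPolynomialRep ρ) (m : ℤ) : ∃ p, ρ (M m) 1 = inT p := by
  by_cases hm : m = 0
  · exact ⟨Polynomial.X, by rw [hm, h.M_zero, mul_one, inT_X]⟩
  have h1 := h.lie (M m) (M (-m)) 1
  rw [lie_M_M, h.M_apply m (ρ (M (-m)) 1), h.M_apply (-m) (ρ (M m) 1), map_zero,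
    LinearMap.zero_apply] at h1
  obtain ⟨p, hp⟩ := exists_eq_inT_of_shift_eq hm
      (f := shift (-m) (ρ (M m) 1) * ρ (M (-m)) 1) (by
    rw [map_mul, shift_shift, add_neg_cancel, shift_zero]
    linear_combination -h1)
  obtain ⟨q, hq⟩ := exists_eq_inT_of_mul_eq_inT (h.M_one_ne_zero (-m)) hp
  refine ⟨q, ?_⟩
  rw [← shift_inT m q, ← hq, shift_shift, add_neg_cancel, shift_zero]

/-- As `[L m, M m] = 0`, the polynomial `L m · 1 - s p'(t)` is periodic in `s`, where
`p(t) = M m · 1`. -/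
theorem exists_L_one_eq (h : IsPolynomialRep ρ) {m : ℤ} {p : Polynomial ℂ}
    (hp : ρ (M m) 1 = inT p) :
    ∃ q, ρ (L m) 1 = s * inT (Polynomial.derivative p) + inT q := by
  by_cases hm : m = 0
  · refine ⟨0, ?_⟩
    rw [hm, h.M_zero, mul_one, ← inT_X] at hp
    rw [hm, h.L_zero, ← inT_injective hp, Polynomial.derivative_X, inT_zero, add_zero,
      ← Polynomial.C_1, inT_C, C_1]
  have h1 := h.lie (L m) (M m) 1
  rw [h.M_apply m (ρ (L m) 1), h.L_apply m (ρ (M m) 1), lie_L_M, sub_self, zero_smul, map_zero,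
    LinearMap.zero_apply, hp, shift_inT, dt_inT] at h1
  have h2 : ρ (L m) 1 - shift m (ρ (L m) 1)
      - (m : MvPolynomial (Fin 2) ℂ) * inT (Polynomial.derivative p) = 0 := by
    refine (mul_eq_zero.mp ?_).resolve_left (hp ▸ h.M_one_ne_zero m)
    linear_combination -h1
  obtain ⟨q, hq⟩ := exists_eq_inT_of_shift_eq hm
      (f := ρ (L m) 1 - s * inT (Polynomial.derivative p)) (by
    rw [map_sub, map_mul, shift_s, shift_inT, map_intCast]
    linear_combination -h2)
  exact ⟨q, by rw [← hq]; ring⟩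

theorem mRecursion (h : IsPolynomialRep ρ) {b : ℤ → Polynomial ℂ}
    (hb : ∀ m, ρ (M m) 1 = inT (b m)) : MRecursion b := by
  intro m n
  obtain ⟨q, hq⟩ := h.exists_L_one_eq (hb m)
  have h1 := h.lie (L m) (M n) 1
  rw [lie_L_M, map_smul, LinearMap.smul_apply, h.L_apply m (ρ (M n) 1),
    h.M_apply n (ρ (L m) 1)] at h1
  simp only [hb, hq, smul_eq_C_mul, map_add, map_mul, map_sub, map_intCast, shift_inT, shift_s,
    dt_inT] at h1
  apply inT_injective
  simp only [inT_sub, inT_mul, inT_intCast]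
  linear_combination -h1

theorem exists_M_one (h : IsPolynomialRep ρ) : ∃ (lam : ℂˣ) (α : ℂ), ∀ m : ℤ,
    ρ (M m) 1 = C ((lam : ℂ) ^ m) * (t - (m : MvPolynomial (Fin 2) ℂ) * C α) := by
  choose b hb using h.exists_M_one_eq_inT
  have h0 : b 0 = Polynomial.X := inT_injective (by rw [← hb, h.M_zero, mul_one, inT_X])
  obtain ⟨lam, α, hl⟩ := (h.mRecursion hb).exists_eq h0 (fun m hm =>
    h.M_one_ne_zero m (by rw [hb, hm, inT_zero]))
  refine ⟨lam, α, fun m => ?_⟩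
  simp only [hb, hl, inT_mul, inT_sub, inT_C, inT_X, inT_intCast, map_mul, map_intCast]

theorem exists_L_one (h : IsPolynomialRep ρ) {lam : ℂˣ} {α : ℂ}
    (hM : ∀ m : ℤ, ρ (M m) 1 = C ((lam : ℂ) ^ m) * (t - (m : MvPolynomial (Fin 2) ℂ) * C α)) :
    ∃ p : Polynomial ℂ, ∀ m : ℤ, ρ (L m) 1 = C ((lam : ℂ) ^ m) * (s + inT (hPoly α p m)) := by
  have h1 (m : ℤ) : ∃ q, ρ (L m) 1 = C ((lam : ℂ) ^ m) * (s + inT q) := by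
    obtain ⟨q, hq⟩ := h.exists_L_one_eq
      (p := Polynomial.C ((lam : ℂ) ^ m) * (Polynomial.X - Polynomial.C (m * α))) (m := m) (by
        simp only [hM, inT_mul, inT_sub, inT_C, inT_X, inT_intCast, map_mul, map_intCast])
    refine ⟨Polynomial.C (((lam : ℂ) ^ m)⁻¹) * q, ?_⟩
    have hl : C ((lam : ℂ) ^ m) * C ((lam : ℂ) ^ m)⁻¹ = (1 : MvPolynomial (Fin 2) ℂ) := by
      rw [← C_mul, mul_inv_cancel₀ (zpow_ne_zero m lam.ne_zero), C_1]
    simp only [Polynomial.derivative_mul, Polynomial.derivative_C, Polynomial.derivative_sub,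
      Polynomial.derivative_X, zero_mul, zero_add, sub_zero, mul_one, inT_C] at hq
    rw [hq, inT_mul, inT_C]
    linear_combination (-inT q) * hl
  choose g hg using h1
  have hr : LRecursion α g := by
    intro m n
    have h2 := h.lie (L m) (L n) 1
    rw [lie_L_L, map_smul, LinearMap.smul_apply, h.L_apply m (ρ (L n) 1),
      h.L_apply n (ρ (L m) 1)] at h2
    have hl : (lam : ℂ) ^ (m + n) = (lam : ℂ) ^ m * (lam : ℂ) ^ n := zpow_add₀ lam.ne_zero m n
    have hne (k : ℤ) : C ((lam : ℂ) ^ k) ≠ (0 : MvPolynomial (Fin 2) ℂ) :=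
      (map_ne_zero_iff C (C_injective _ _)).mpr (zpow_ne_zero k lam.ne_zero)
    simp only [hM, hg, hl, smul_eq_C_mul, map_add, map_mul, map_sub, map_intCast, shift_C,
      shift_inT, shift_s, dt_mul, dt_C, dt_s, dt_intCast, dt_inT] at h2
    apply inT_injective
    apply mul_left_cancel₀ (hne m)
    apply mul_left_cancel₀ (hne n)
    simp only [inT_add, inT_sub, inT_mul, inT_intCast, inT_X, inT_C, map_mul, map_intCast]
    linear_combination -h2
  have h0 : g 0 = 0 := by
    have h3 := hg 0
    rw [h.L_zero, zpow_zero, C_1, one_mul, mul_one, left_eq_add, ← inT_zero] at h3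
    exact inT_injective h3
  exact ⟨g 1, fun m => by rw [hg, hr.eq_hPoly h0]⟩

theorem exists_S_one (h : IsPolynomialRep ρ) {lam : ℂˣ} {α : ℂ}
    (hM : ∀ m : ℤ, ρ (M m) 1 = C ((lam : ℂ) ^ m) * (t - (m : MvPolynomial (Fin 2) ℂ) * C α))
    {p : Polynomial ℂ}
    (hL : ∀ m : ℤ, ρ (L m) 1 = C ((lam : ℂ) ^ m) * (s + inT (hPoly α p m))) :
    ∃ β : ℂ, ∀ m : ℤ, ρ (S m) 1 = C ((lam : ℂ) ^ m) * C β := by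
  have hne (k : ℤ) : C ((lam : ℂ) ^ k) ≠ (0 : MvPolynomial (Fin 2) ℂ) :=
    (map_ne_zero_iff C (C_injective _ _)).mpr (zpow_ne_zero k lam.ne_zero)
  have h1 (n : ℤ) : ∃ q, ρ (S n) 1 = C ((lam : ℂ) ^ n) * inT q := by
    have h2 := h.lie (M 1) (S n) 1
    rw [lie_M_S, h.M_apply 1 (ρ (S n) 1), h.S_apply n (ρ (M 1) 1), map_zero,
      LinearMap.zero_apply] at h2
    have h3 : shift n (ρ (M 1) 1) = ρ (M 1) 1 := by
      simp only [hM, map_mul, map_sub, shift_C, shift_t, map_intCast]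
    rw [h3] at h2
    obtain ⟨q, hq⟩ := exists_eq_inT_of_shift_eq one_ne_zero (f := ρ (S n) 1)
      (mul_left_cancel₀ (h.M_one_ne_zero 1) (by linear_combination -h2))
    refine ⟨Polynomial.C (((lam : ℂ) ^ n)⁻¹) * q, ?_⟩
    rw [hq, inT_mul, inT_C, ← mul_assoc, ← C_mul,
      mul_inv_cancel₀ (zpow_ne_zero n lam.ne_zero), C_1, one_mul]
  choose e he using h1
  obtain ⟨β, hβ⟩ := exists_eq_C_of_recursion (α := α) (e := e) (by
    intro m n
    have h2 := h.lie (L m) (S n) 1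
    rw [lie_L_S, map_smul, LinearMap.smul_apply, h.L_apply m (ρ (S n) 1),
      h.S_apply n (ρ (L m) 1)] at h2
    have hl : (lam : ℂ) ^ (m + n) = (lam : ℂ) ^ m * (lam : ℂ) ^ n := zpow_add₀ lam.ne_zero m n
    simp only [hM, hL, he, hl, smul_eq_C_mul, map_add, map_mul, map_intCast,
      shift_C, shift_inT, shift_s, dt_mul, dt_C, dt_inT] at h2
    apply inT_injective
    apply mul_left_cancel₀ (hne m)
    apply mul_left_cancel₀ (hne n)
    simp only [inT_sub, inT_mul, inT_intCast, inT_X, inT_C, map_mul, map_intCast]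
    linear_combination -h2)
  exact ⟨β, fun m => by rw [he, hβ, inT_C]⟩

theorem exists_I_one (h : IsPolynomialRep ρ) {lam : ℂˣ} {α : ℂ}
    (hM : ∀ m : ℤ, ρ (M m) 1 = C ((lam : ℂ) ^ m) * (t - (m : MvPolynomial (Fin 2) ℂ) * C α))
    {p : Polynomial ℂ}
    (hL : ∀ m : ℤ, ρ (L m) 1 = C ((lam : ℂ) ^ m) * (s + inT (hPoly α p m)))
    {β : ℂ} (hS : ∀ m : ℤ, ρ (S m) 1 = C ((lam : ℂ) ^ m) * C β) :
    ∃ γ : ℂ, ∀ m : ℤ, ρ (I m) 1 = C ((lam : ℂ) ^ m) *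
      (C γ - (m : MvPolynomial (Fin 2) ℂ) * C β * inT (quot α p)) := by
  have hne (k : ℤ) : C ((lam : ℂ) ^ k) ≠ (0 : MvPolynomial (Fin 2) ℂ) :=
    (map_ne_zero_iff C (C_injective _ _)).mpr (zpow_ne_zero k lam.ne_zero)
  have hl (m n : ℤ) : (lam : ℂ) ^ (m + n) = (lam : ℂ) ^ m * (lam : ℂ) ^ n :=
    zpow_add₀ lam.ne_zero m n
  have h1 (n : ℤ) : ∃ q, ρ (I n) 1 = C ((lam : ℂ) ^ n) * inT q := by
    have h2 := h.lie (M 1) (I n) 1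
    rw [lie_M_I, h.M_apply 1 (ρ (I n) 1), h.I_apply n (ρ (M 1) 1), map_smul,
      LinearMap.smul_apply] at h2
    have h3 : shift 1 (ρ (I n) 1) = ρ (I n) 1 := by
      apply mul_left_cancel₀ (h.M_one_ne_zero 1)
      simp only [hM, hS, hl, smul_eq_C_mul, map_mul, map_sub, map_neg, map_intCast,
        shift_C, shift_t, dt_mul, dt_C, dt_t, dt_intCast]
        at h2 ⊢
      linear_combination -h2
    obtain ⟨q, hq⟩ := exists_eq_inT_of_shift_eq one_ne_zero h3
    refine ⟨Polynomial.C (((lam : ℂ) ^ n)⁻¹) * q, ?_⟩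
    rw [hq, inT_mul, inT_C, ← mul_assoc, ← C_mul,
      mul_inv_cancel₀ (zpow_ne_zero n lam.ne_zero), C_1, one_mul]
  choose e he using h1
  -- Adding `n β (h(t) - h(α)) / (t - α)` turns the recursion into the homogeneous one for `S n`.
  obtain ⟨γ, hγ⟩ := exists_eq_C_of_recursion (α := α)
      (e := fun n => e n + (n : Polynomial ℂ) * Polynomial.C β * quot α p) (by
    intro m n
    have h2 := h.lie (L m) (I n) 1
    rw [lie_L_I, map_smul, LinearMap.smul_apply, h.L_apply m (ρ (I n) 1),
      h.I_apply n (ρ (L m) 1)] at h2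
    simp only [hM, hL, hS, he, hl, hPoly_eq, inT_add, inT_sub, inT_mul, inT_intCast, inT_X, inT_C,
      smul_eq_C_mul, map_add, map_mul, map_sub, map_intCast, shift_C, shift_t,
      shift_inT, shift_s, dt_mul, dt_C, dt_s, dt_t, dt_inT, dt_intCast] at h2
    apply inT_injective
    apply mul_left_cancel₀ (hne m)
    apply mul_left_cancel₀ (hne n)
    simp only [inT_add, inT_sub, inT_mul, inT_intCast, inT_X, inT_C, map_mul, map_intCast,
      Polynomial.derivative_add, Polynomial.derivative_mul, Polynomial.derivative_C,
      Polynomial.derivative_intCast, inT_zero, Int.cast_add] at h2 ⊢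
    linear_combination -h2)
  refine ⟨γ, fun m => ?_⟩
  rw [he, eq_sub_of_add_eq (hγ m)]
  simp only [inT_sub, inT_mul, inT_intCast, inT_C]

/-- Every polynomial representation is one of the modules `Φ(λ, α, β, γ, h(t))`. -/
theorem exists_eq_rho (h : IsPolynomialRep ρ) :
    ∃ (lam : ℂˣ) (α β γ : ℂ) (p : Polynomial ℂ), ρ = rho lam α β γ p := by
  obtain ⟨lam, α, hM⟩ := h.exists_M_one
  obtain ⟨p, hL⟩ := h.exists_L_one hM
  obtain ⟨β, hS⟩ := h.exists_S_one hM hL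
  obtain ⟨γ, hI⟩ := h.exists_I_one hM hL hS
  refine ⟨lam, α, β, γ, p, BMSKacMoody.basis.ext fun i => LinearMap.ext fun f => ?_⟩
  rw [rho_basis]
  obtain ⟨a, m⟩ := i
  cases a
  · refine (h.L_apply m f).trans ?_
    simp only [hL, hM, act, map_mul, map_intCast]
    ring
  · refine (h.M_apply m f).trans ?_
    simp only [hM, act, map_mul, map_intCast]
    ring
  · refine (h.S_apply m f).trans ?_
    simp only [hS, act, map_mul]
    ring
  · refine (h.I_apply m f).trans ?_
    simp only [hI, hS, act, map_mul, map_intCast]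
    ring

end IsPolynomialRep

end BMSPhi

/-! ### The classification -/

namespace BMSPhi

open MvPolynomial

theorem rho_L_zero (lam : ℂˣ) (α β γ : ℂ) (h : Polynomial ℂ) (f : MvPolynomial (Fin 2) ℂ) :
    rho lam α β γ h (L 0) f = s * f := by
  refine (rho_basis lam α β γ h _ f).trans ?_
  simp [act, hPoly, inT_zero, shift_zero]

theorem rho_M_zero (lam : ℂˣ) (α β γ : ℂ) (h : Polynomial ℂ) (f : MvPolynomial (Fin 2) ℂ) :
    rho lam α β γ h (M 0) f = t * f := by
  refine (rho_basis lam α β γ h _ f).trans ?_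
  simp [act, shift_zero]

theorem polyAction_eq_mul (lam : ℂˣ) (α β γ : ℂ) (h : Polynomial ℂ)
    (f g : MvPolynomial (Fin 2) ℂ) : polyAction (BMSPhi lam α β γ h) f g = f * g := by
  induction f using MvPolynomial.induction_on generalizing g with
  | C a =>
    rw [← algebraMap_eq, AlgHom.commutes, ← Algebra.smul_def]
    rfl
  | add p q hp hq =>
    rw [map_add, add_mul, ← hp, ← hq]
    rfl
  | mul_X p i hp =>
    rw [map_mul, mul_assoc, ← hp]
    refine congrArg (polyAction (BMSPhi lam α β γ h) p) ?_
    fin_cases i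
    · exact (polyAction_s (BMSPhi lam α β γ h) g).trans (rho_L_zero lam α β γ h g)
    · exact (polyAction_t (BMSPhi lam α β γ h) g).trans (rho_M_zero lam α β γ h g)

theorem isCartanFreeOfRankOne (lam : ℂˣ) (α β γ : ℂ) (h : Polynomial ℂ) :
    IsCartanFreeOfRankOne (BMSPhi lam α β γ h) := by
  refine (isCartanFreeOfRankOne_iff _).mpr ⟨(1 : MvPolynomial (Fin 2) ℂ), ?_⟩
  have hf (f : MvPolynomial (Fin 2) ℂ) :
      polyAction (BMSPhi lam α β γ h) f (1 : MvPolynomial (Fin 2) ℂ) = f :=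
    (polyAction_eq_mul lam α β γ h f 1).trans (mul_one f)
  exact ⟨fun f g hfg => (hf f).symm.trans (hfg.trans (hf g)), fun f => ⟨f, hf f⟩⟩

theorem exists_equiv (V : Type*) [AddCommGroup V] [Module ℂ V]
    [LieRingModule BMSKacMoody V] [LieModule ℂ BMSKacMoody V] (hV : IsCartanFreeOfRankOne V) :
    ∃ (lam : ℂˣ) (α β γ : ℂ) (h : Polynomial ℂ),
      Nonempty (V ≃ₗ⁅ℂ,BMSKacMoody⁆ BMSPhi lam α β γ h) := by
  obtain ⟨v, hv⟩ := (isCartanFreeOfRankOne_iff V).mp hV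
  let e : MvPolynomial (Fin 2) ℂ ≃ₗ[ℂ] V :=
    LinearEquiv.ofBijective (LinearMap.applyₗ v ∘ₗ (polyAction V).toLinearMap) hv
  have he (f g : MvPolynomial (Fin 2) ℂ) : e (f * g) = polyAction V f (e g) :=
    congrArg (fun T : Module.End ℂ V => T v) (map_mul (polyAction V) f g)
  let ρ : BMSKacMoody →ₗ[ℂ] MvPolynomial (Fin 2) ℂ →ₗ[ℂ] MvPolynomial (Fin 2) ℂ :=
    e.symm.conj.toLinearMap ∘ₗ (LieModule.toEnd ℂ BMSKacMoody V : BMSKacMoody →ₗ[ℂ] _)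
  have hρ (x : BMSKacMoody) (f : MvPolynomial (Fin 2) ℂ) : e (ρ x f) = ⁅x, e f⁆ :=
    e.apply_symm_apply _
  have hrep : IsPolynomialRep ρ := by
    refine ⟨fun x y f => e.injective ?_, fun f => e.injective ?_, fun f => e.injective ?_⟩
    · rw [map_sub, hρ, hρ, hρ, hρ, hρ, lie_lie]
    · rw [hρ, he, polyAction_s]
    · rw [hρ, he, polyAction_t]
  obtain ⟨lam, α, β, γ, h, hρ'⟩ := hrep.exists_eq_rho
  refine ⟨lam, α, β, γ, h, ⟨{ e.symm with map_lie' := ?_ }⟩⟩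
  intro x w
  have h1 : e.symm ⁅x, w⁆ = ρ x (e.symm w) := by
    rw [LinearEquiv.symm_apply_eq, hρ, e.apply_symm_apply]
  exact h1.trans (by rw [hρ']; rfl)

/-- An isomorphism commutes with `s` and `t`, so it is the multiplication by an invertible
polynomial, that is, by a nonzero constant. -/
theorem rho_one_eq_of_equiv {lam lam' : ℂˣ} {α β γ α' β' γ' : ℂ} {h h' : Polynomial ℂ}
    (T : BMSPhi lam α β γ h ≃ₗ⁅ℂ,BMSKacMoody⁆ BMSPhi lam' α' β' γ' h') (x : BMSKacMoody) :
    rho lam α β γ h x 1 = rho lam' α' β' γ' h' x 1 := by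
  let T' : MvPolynomial (Fin 2) ℂ ≃ₗ[ℂ] MvPolynomial (Fin 2) ℂ := T.toLinearEquiv
  have hT (x : BMSKacMoody) (f : MvPolynomial (Fin 2) ℂ) :
      T' (rho lam α β γ h x f) = rho lam' α' β' γ' h' x (T' f) := T.map_lie' (x := x) (m := f)
  have hmul (f : MvPolynomial (Fin 2) ℂ) : T' f = f * T' 1 := by
    have := apply_eq_shift_mul (T := T'.toLinearMap) (m := 0)
      (fun f => by
        have := hT (L 0) f
        rw [rho_L_zero, rho_L_zero] at this
        simpa using this)
      (fun f => by
        have := hT (M 0) f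
        rwa [rho_M_zero, rho_M_zero] at this) f
    rwa [shift_zero] at this
  have hunit : IsUnit (T' 1) :=
    IsUnit.of_mul_eq_one (T'.symm 1) (by rw [mul_comm, ← hmul, T'.apply_symm_apply])
  obtain ⟨c, hc, hc'⟩ := isUnit_iff_eq_C_of_isReduced.mp hunit
  have h1 := hT x 1
  rw [hmul, hc', show C c = c • (1 : MvPolynomial (Fin 2) ℂ) by rw [smul_eq_C_mul, mul_one],
    map_smul, mul_smul_comm, mul_one] at h1
  exact smul_right_injective _ hc.ne_zero h1

theorem parameters_eq_of_equiv {lam lam' : ℂˣ} {α β γ α' β' γ' : ℂ} {h h' : Polynomial ℂ}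
    (T : BMSPhi lam α β γ h ≃ₗ⁅ℂ,BMSKacMoody⁆ BMSPhi lam' α' β' γ' h') :
    lam = lam' ∧ α = α' ∧ β = β' ∧ γ = γ' ∧ h = h' := by
  have key (i : BMSGen × ℤ) : act lam α β γ h i 1 = act lam' α' β' γ' h' i 1 := by
    rw [← rho_basis, ← rho_basis, rho_one_eq_of_equiv T]
  have hM := key (.M, 1)
  have hM' : Polynomial.C (lam : ℂ) * (Polynomial.X - Polynomial.C α)
      = Polynomial.C (lam' : ℂ) * (Polynomial.X - Polynomial.C α') := by
    apply inT_injective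
    simpa [act, inT_mul, inT_sub, inT_C, inT_X] using hM
  have hlam : lam = lam' := by
    have := congrArg (fun p => Polynomial.coeff p 1) hM'
    exact Units.ext (by simpa [Polynomial.coeff_C] using this)
  have hα : α = α' := by
    have := congrArg (fun p => Polynomial.coeff p 0) hM'
    simpa [hlam] using this
  have hβ : β = β' := C_injective (Fin 2) ℂ (by simpa [act] using key (.S, 0))
  have hγ : γ = γ' := C_injective (Fin 2) ℂ (by simpa [act] using key (.I, 0))
  have hL := key (.L, 1)
  subst hlam
  have hh : h = h' := inT_injective (by simpa [act, hPoly_one, dt, ← mul_add] using hL)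
  exact ⟨rfl, hα, hβ, hγ, hh⟩

end BMSPhi

theorem mainTheorem1 :
    (∀ (V : Type*) [AddCommGroup V] [Module ℂ V]
      [LieRingModule BMSKacMoody V] [LieModule ℂ BMSKacMoody V],
      BMSKacMoody.IsCartanFreeOfRankOne V →
        ∃ (lam : ℂˣ) (α β γ : ℂ) (h : Polynomial ℂ),
          Nonempty (V ≃ₗ⁅ℂ,BMSKacMoody⁆ BMSPhi lam α β γ h)) ∧
    (∀ (lam : ℂˣ) (α β γ : ℂ) (h : Polynomial ℂ),
      BMSKacMoody.IsCartanFreeOfRankOne (BMSPhi lam α β γ h)) ∧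
    (∀ (lam lam' : ℂˣ) (α β γ α' β' γ' : ℂ) (h h' : Polynomial ℂ),
      Nonempty (BMSPhi lam α β γ h ≃ₗ⁅ℂ,BMSKacMoody⁆ BMSPhi lam' α' β' γ' h') →
        lam = lam' ∧ α = α' ∧ β = β' ∧ γ = γ' ∧ h = h') :=
  ⟨fun V _ _ _ _ hV => BMSPhi.exists_equiv V hV, BMSPhi.isCartanFreeOfRankOne,
    fun _ _ _ _ _ _ _ _ _ _ ⟨T⟩ => BMSPhi.parameters_eq_of_equiv T⟩
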